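/- Let $G=(V,E)$ be a finite simple graph with nonempty vertex set and let $\alpha>1$. For $e\in E$ and $\vec v\in[0,\infty)^E$ put \[ F(\vec v)_e=-v_e+\sum_{A\subseteq E,\ A\ni e}p_A\,\frac{v_e^{\alpha}}{\sum_{e'\in A}v_{e'}^{\alpha}}, \] where $p_A$ is the probability that the set of edges incident to a uniformly random vertex of $G$ equals $A$. An equilibrium is a vector $\vec v\in[0,1]^E$ with $\sum_{e\in E}v_e=1$ and $F(\vec v)=\vec 0$. Let $\mathbf D(\vec v)$ be the matrix of partial derivatives $\partial F_e/\partial v_{e'}$ at $\vec v$ (one-sided when $v_{e'}=0$). An equilibrium at which these partial derivatives exist is linearly stable if all eigenvalues of $\mathbf D(\vec v)$ have negative real part, linearly unstable if some eigenvalue has positive real part, and critical otherwise. A star-forest on $G$ is a collection $\mathbf G=\{G_1,\dots,G_k\}$ of (not necessarily induced) subgraphs of $G$ whose vertex sets partition $V$, each $G_j$ being a star with at least one edge, i.e. a center joined to $m\ge 1$ leaves, with no other edges. Theorem. For every finite simple graph $G$ with nonempty vertex set, every $\alpha>1$ and every star-forest $\mathbf G$ on $G$, the star-forest admits a $(G,\alpha)$-stable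 allocation: there is an equilibrium $\vec v$, linearly stable or critical, such that $v_e>0$ for every edge $e$ of every $G_j$, and $v_e=0$ for every other edge $e$ of $G$. -/

import Mathlib

/-!
Equilibria and linear stability for reinforcement models in which, at each step, a random nonempty
set `A` of colours is drawn (with probability `p A`) and then a colour `i ∈ A` is selected with
probability proportional to `W (number of balls of colour i)`, where `W x = x ^ α`.
-/

namespace WARM

/-! ### The general model, with a finite set `ι` of colours -/

section General

variable {ι : Type*} [Fintype ι] [DecidableEq ι]

/-- The vector field `F(v)_i = -v_i + ∑_{A ∋ i} p_A v_i^α / ∑_{j ∈ A} v_j^α`. -/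
noncomputable def drift (p : Finset ι → ℝ) (α : ℝ) (v : ι → ℝ) (i : ι) : ℝ :=
  -v i + ∑ A ∈ Finset.univ.filter (fun A : Finset ι => i ∈ A),
    p A * (v i ^ α / ∑ j ∈ A, v j ^ α)

/-- For `v ≥ 0` the vector field is the limit, as `t → ∞`, of
`-v_i + ∑_{A ∋ i} p_A W(v_i t) / ∑_{j ∈ A} W(v_j t)` with `W x = x ^ α`. -/
theorem tendsto_drift (p : Finset ι → ℝ) (α : ℝ) (v : ι → ℝ) (hv : ∀ i, 0 ≤ v i) (i : ι) :
    Filter.Tendsto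
      (fun t : ℝ => -v i + ∑ A ∈ Finset.univ.filter (fun A : Finset ι => i ∈ A),
        p A * ((v i * t) ^ α / ∑ j ∈ A, (v j * t) ^ α))
      Filter.atTop (nhds (drift p α v i)) := by
  refine tendsto_const_nhds.congr' ?_
  filter_upwards [Filter.eventually_gt_atTop (0 : ℝ)] with t ht
  have h : ∀ j, (v j * t) ^ α = v j ^ α * t ^ α := fun j => Real.mul_rpow (hv j) ht.le
  simp only [drift, h, ← Finset.sum_mul]
  congr 1
  refine Finset.sum_congr rfl fun A _ => ?_
  rw [mul_div_mul_right _ _ (Real.rpow_pos_of_pos ht α).ne']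

/-- `v` is an equilibrium: a point of the standard simplex at which `F` vanishes. -/
def IsEquilibrium (p : Finset ι → ℝ) (α : ℝ) (v : ι → ℝ) : Prop :=
  v ∈ stdSimplex ℝ ι ∧ ∀ i, drift p α v i = 0

/-- All partial derivatives `∂F_i/∂v_k` exist at `v`. They are taken within the nonnegative
orthant, that is, from the right when `v k = 0`. -/
def HasPartials (p : Finset ι → ℝ) (α : ℝ) (v : ι → ℝ) : Prop :=
  ∀ i k, DifferentiableWithinAt ℝ (fun t : ℝ => drift p α (Function.update v k t) i)
    (Set.Ici 0) (v k)

/-- The matrix `D(v)` of partial derivatives `∂F_i/∂v_k` at `v`. -/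
noncomputable def jacobian (p : Finset ι → ℝ) (α : ℝ) (v : ι → ℝ) : Matrix ι ι ℝ :=
  Matrix.of fun i k =>
    derivWithin (fun t : ℝ => drift p α (Function.update v k t) i) (Set.Ici 0) (v k)

/-- `z` is a (complex) eigenvalue of `D(v)`. -/
def IsJacobianEigenvalue (p : Finset ι → ℝ) (α : ℝ) (v : ι → ℝ) (z : ℂ) : Prop :=
  Module.End.HasEigenvalue (Matrix.toLin' ((jacobian p α v).map Complex.ofReal)) z

/-- Linearly stable equilibrium: all eigenvalues of `D(v)` have negative real part. -/
def IsLinearlyStable (p : Finset ι → ℝ) (α : ℝ) (v : ι → ℝ) : Prop :=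
  IsEquilibrium p α v ∧ HasPartials p α v ∧ ∀ z, IsJacobianEigenvalue p α v z → z.re < 0

/-- Linearly unstable equilibrium: some eigenvalue of `D(v)` has positive real part. -/
def IsLinearlyUnstable (p : Finset ι → ℝ) (α : ℝ) (v : ι → ℝ) : Prop :=
  IsEquilibrium p α v ∧ HasPartials p α v ∧ ∃ z, IsJacobianEigenvalue p α v z ∧ 0 < z.re

/-- Critical equilibrium: neither linearly stable nor linearly unstable. -/
def IsCritical (p : Finset ι → ℝ) (α : ℝ) (v : ι → ℝ) : Prop :=
  IsEquilibrium p α v ∧ HasPartials p α v ∧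
    ¬ IsLinearlyStable p α v ∧ ¬ IsLinearlyUnstable p α v

end General

/-! ### The model on a graph: colours are edges, and `A` is the set of edges incident to a
uniformly chosen vertex -/

section Graph

variable {V : Type*} [Fintype V] [DecidableEq V] (G : SimpleGraph V) [DecidableRel G.Adj]

/-- The set of edges incident to the vertex `x`. -/
def incident (x : V) : Finset G.edgeSet :=
  Finset.univ.filter fun e => x ∈ (e : Sym2 V)

/-- The probability that the set of edges incident to a uniformly random vertex equals `A`. -/
noncomputable def graphLaw (A : Finset G.edgeSet) : ℝ :=
  ((Finset.univ.filter fun x : V => incident G x = A).card : ℝ) / (Fintype.card V : ℝ)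

end Graph

section Clusters

variable {V : Type*} [Fintype V] {G : SimpleGraph V}

/-- A spanning collection of nontrivial connected clusters of `G`: connected subgraphs (not
necessarily induced) with at least two vertices each, whose vertex sets partition the vertex
set of `G`. -/
structure IsClusterCollection (C : Finset G.Subgraph) : Prop where
  card_le : (C.card : ℝ) ≤ (Fintype.card V : ℝ) / 2
  connected : ∀ H ∈ C, H.Connected
  nontrivial : ∀ H ∈ C, 2 ≤ H.verts.ncard
  cover : ∀ x : V, ∃ H ∈ C, x ∈ H.verts
  disjoint : ∀ H ∈ C, ∀ K ∈ C, H ≠ K → Disjoint H.verts K.verts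

/-- The subgraph `H` is a star: its edges are exactly those joining some center `c` to all its
other vertices. -/
def IsStar (H : G.Subgraph) : Prop :=
  ∃ c : H.verts, H.coe = SimpleGraph.starGraph c

/-- A star-forest on `G`: a spanning collection of nontrivial clusters, each of which is a star
(with at least one edge). -/
def IsStarForest (C : Finset G.Subgraph) : Prop :=
  IsClusterCollection C ∧ ∀ H ∈ C, IsStar H

/-- `e` is an edge of one of the clusters. -/
def IsClusterEdge (C : Finset G.Subgraph) (e : G.edgeSet) : Prop :=
  ∃ H ∈ C, (e : Sym2 V) ∈ H.edgeSet

/-- The collection `C` admits a `(G, α)`-stable allocation. -/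
def AdmitsStableAllocation [DecidableEq V] [DecidableRel G.Adj]
    (C : Finset G.Subgraph) (α : ℝ) : Prop :=
  ∃ v : G.edgeSet → ℝ,
    (∀ e, IsClusterEdge C e → 0 < v e) ∧
    (∀ e, ¬ IsClusterEdge C e → v e = 0) ∧
    (IsLinearlyStable (graphLaw G) α v ∨ IsCritical (graphLaw G) α v)

end Clusters

end WARM

/-!
Write `T_A(v) = ∑_{j ∈ A} v_j^α`. The drift is the gradient of
`Φ(v) = -∑_e v_e + α⁻¹ ∑_A p_A log T_A(v)` in the logarithmic coordinates `y_e = log v_e`: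
`∂Φ/∂y_e = F_e`. Hence a maximizer of `Φ` over the vectors supported exactly on a set `S` of colours
is an equilibrium, and there the Hessian of `Φ` in these coordinates, which is `(D_{ek} v_k)` for
`e, k ∈ S`, is negative semidefinite. As `α > 1`, a row of `D` indexed by `e ∉ S` is minus a unit
vector, and an entry `D_{ek}` with `e ∈ S`, `k ∉ S` is zero. So `diag(d) D` has nonpositive
quadratic form for `d_e = 1 / v_e` on `S` and `d_e = 1` off `S`, and no eigenvalue of `D` has positive real
part: the equilibrium is linearly stable or critical (`exists_stable_or_critical`).

Since `Φ` is maximal along each ray where `∑_e v_e = 1`, it suffices to maximize `∏_A T_A(v)^{p_A}`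
over the vectors of the standard simplex that vanish off `S`, a compact set. Two conditions keep the
maximizer positive on `S`: every `A` with `p_A > 0` meets `S`, so that the maximum is positive, and
every `e ∈ S` is the only element of `S` in some `A` with `p_A > 0`, so that this factor vanishes as
soon as `v_e` does. For the edges of a star-forest they hold, as the stars cover the vertices and
every edge of a star has an endpoint, a leaf, that lies on no other edge of the forest.
-/

namespace WARM

section General

variable {ι : Type*} [Fintype ι]

/-! ### The potential and its maximizers -/

/-- The potential `∏_A (∑_{j ∈ A} v_j^α)^{p_A}`. It is kept as a product, without logarithms, to be
continuous up to the boundary of the simplex. -/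
noncomputable def potential (p : Finset ι → ℝ) (α : ℝ) (v : ι → ℝ) : ℝ :=
  ∏ A, (∑ j ∈ A, v j ^ α) ^ p A

/-- Along each curve `v_j e^{s_j t}` through a maximizer `v` of the potential, a curve that leaves
the simplex, the logarithm of the potential, corrected by a multiple of the total mass, is maximal at
`t = 0`. -/
theorem log_potential_curve_le {p : Finset ι → ℝ} (hsum : ∑ A, p A = 1) {α : ℝ} (hα : 0 < α)
    {S : Finset ι} {v : ι → ℝ} (hv : v ∈ stdSimplex ℝ ι) (hv0 : ∀ e ∉ S, v e = 0)
    (hpos : ∀ A, p A ≠ 0 → 0 < ∑ j ∈ A, v j ^ α)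
    (hmax : ∀ w ∈ stdSimplex ℝ ι, (∀ e ∉ S, w e = 0) → potential p α w ≤ potential p α v)
    (s : ι → ℝ) (t : ℝ) :
    α * (1 - ∑ j, v j * Real.exp (s j * t)) +
        ∑ A, p A * Real.log (∑ j ∈ A, v j ^ α * Real.exp (α * s j * t)) ≤
      ∑ A, p A * Real.log (∑ j ∈ A, v j ^ α) := by
  set B := ∑ j, v j * Real.exp (s j * t)
  obtain ⟨e₀, he₀⟩ : ∃ e, 0 < v e := by
    by_contra! h
    have := Finset.sum_nonpos fun e (_ : e ∈ Finset.univ) => h e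
    rw [hv.2] at this; linarith
  have hB : 0 < B := Finset.sum_pos' (fun j _ => mul_nonneg (hv.1 j) (Real.exp_pos _).le)
    ⟨e₀, Finset.mem_univ _, by positivity⟩
  have hT : ∀ A, p A ≠ 0 → 0 < ∑ j ∈ A, v j ^ α * Real.exp (α * s j * t) := fun A hA => by
    obtain ⟨j, hj, hj'⟩ := Finset.exists_ne_zero_of_sum_ne_zero (hpos A hA).ne'
    have h0 : ∀ j, 0 ≤ v j ^ α := fun j => Real.rpow_nonneg (hv.1 j) α
    exact Finset.sum_pos' (fun j _ => mul_nonneg (h0 j) (Real.exp_pos _).le)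
      ⟨j, hj, mul_pos ((h0 j).lt_of_ne' hj') (Real.exp_pos _)⟩
  let w : ι → ℝ := fun j => v j * Real.exp (s j * t) / B
  have hw : potential p α w ≤ potential p α v := by
    refine hmax w ⟨fun j => ?_, ?_⟩ fun e he => by simp [w, hv0 e he]
    · exact div_nonneg (mul_nonneg (hv.1 j) (Real.exp_pos _).le) hB.le
    · simp only [w, ← Finset.sum_div]; exact div_self hB.ne'
  have hwsum : ∀ A : Finset ι, ∑ j ∈ A, w j ^ α =
      (∑ j ∈ A, v j ^ α * Real.exp (α * s j * t)) / B ^ α := fun A => by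
    rw [Finset.sum_div]
    refine Finset.sum_congr rfl fun j _ => ?_
    simp only [w]
    rw [Real.div_rpow (mul_nonneg (hv.1 j) (Real.exp_pos _).le) hB.le,
      Real.mul_rpow (hv.1 j) (Real.exp_pos _).le, ← Real.exp_mul]
    congr 3; ring
  have hlog : ∀ x : ι → ℝ, (∀ A, p A ≠ 0 → 0 < ∑ j ∈ A, x j ^ α) →
      0 < potential p α x ∧
        Real.log (potential p α x) = ∑ A, p A * Real.log (∑ j ∈ A, x j ^ α) := fun x hx => by
    have h : ∀ A, 0 < (∑ j ∈ A, x j ^ α) ^ p A := fun A => by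
      by_cases hA : p A = 0
      · simp [hA]
      · exact Real.rpow_pos_of_pos (hx A hA) _
    refine ⟨Finset.prod_pos fun A _ => h A, ?_⟩
    rw [potential, Real.log_prod fun A _ => (h A).ne']
    refine Finset.sum_congr rfl fun A _ => ?_
    by_cases hA : p A = 0
    · simp [hA]
    · exact Real.log_rpow (hx A hA) _
  have hBα : 0 < B ^ α := Real.rpow_pos_of_pos hB α
  obtain ⟨hwp, hwl⟩ := hlog w fun A hA => by rw [hwsum]; exact div_pos (hT A hA) hBα
  have hle := Real.log_le_log hwp hw
  rw [hwl, (hlog v hpos).2] at hle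
  have hsplit : ∑ A, p A * Real.log (∑ j ∈ A, w j ^ α) =
      ∑ A, p A * Real.log (∑ j ∈ A, v j ^ α * Real.exp (α * s j * t)) - α * Real.log B := by
    rw [← one_mul (α * Real.log B), ← hsum, Finset.sum_mul, ← Finset.sum_sub_distrib]
    refine Finset.sum_congr rfl fun A _ => ?_
    by_cases hA : p A = 0
    · simp [hA]
    · rw [hwsum, Real.log_div (hT A hA).ne' hBα.ne', Real.log_rpow hB]; ring
  have := mul_le_mul_of_nonneg_left (Real.log_le_sub_one_of_pos hB) hα.le
  linarith

variable [DecidableEq ι]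

theorem exists_isMaxOn_potential {p : Finset ι → ℝ} (hp : ∀ A, 0 ≤ p A) {α : ℝ} (hα : 0 < α)
    {S : Finset ι} (hS : S.Nonempty) (hmeet : ∀ A, p A ≠ 0 → ∃ e ∈ A, e ∈ S) :
    ∃ v ∈ stdSimplex ℝ ι, (∀ e ∉ S, v e = 0) ∧ (∀ A, p A ≠ 0 → 0 < ∑ j ∈ A, v j ^ α) ∧
      ∀ w ∈ stdSimplex ℝ ι, (∀ e ∉ S, w e = 0) → potential p α w ≤ potential p α v := by
  have hcont : Continuous (potential p α) := by
    refine continuous_finsetProd _ fun A _ => ?_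
    refine Continuous.rpow_const (continuous_finsetSum _ fun j _ => ?_) fun _ => Or.inr (hp A)
    exact (continuous_apply j).rpow_const fun _ => Or.inr hα.le
  have hcomp : IsCompact (stdSimplex ℝ ι ∩ {v | ∀ e ∉ S, v e = 0}) := by
    refine (isCompact_stdSimplex ℝ ι).inter_right ?_
    simp only [Set.ofPred_forall]
    exact isClosed_iInter fun e => isClosed_iInter fun _ =>
      isClosed_eq (continuous_apply e) continuous_const
  have hcard : (0 : ℝ) < S.card := by exact_mod_cast hS.card_pos
  -- The barycentre of the face has positive potential.
  let u : ι → ℝ := fun e => if e ∈ S then (S.card : ℝ)⁻¹ else 0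
  have hu : u ∈ stdSimplex ℝ ι ∩ {v | ∀ e ∉ S, v e = 0} := by
    refine ⟨⟨fun e => ?_, ?_⟩, fun e he => by simp [u, he]⟩
    · simp only [u]; split_ifs <;> positivity
    · simp [u, hcard.ne']
  obtain ⟨v, ⟨hv, hv0⟩, hmax⟩ := hcomp.exists_isMaxOn ⟨u, hu⟩ hcont.continuousOn
  refine ⟨v, hv, hv0, fun A hA => ?_, fun w hw hw0 => hmax ⟨hw, hw0⟩⟩
  have hupos : 0 < potential p α u := by
    refine Finset.prod_pos fun B _ => ?_
    by_cases hB : p B = 0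
    · simp [hB]
    obtain ⟨e, heB, heS⟩ := hmeet B hB
    refine Real.rpow_pos_of_pos (Finset.sum_pos' (fun j _ => Real.rpow_nonneg (hu.1.1 j) α)
      ⟨e, heB, Real.rpow_pos_of_pos ?_ α⟩) _
    simp only [u, heS, if_true]; positivity
  have hvpos : 0 < potential p α v := hupos.trans_le (hmax hu)
  refine (Finset.sum_nonneg fun j _ => Real.rpow_nonneg (hv.1 j) α).lt_of_ne' fun h0 => ?_
  refine hvpos.ne' (Finset.prod_eq_zero (Finset.mem_univ A) ?_)
  rw [h0, Real.zero_rpow hA]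

/-! ### First- and second-order conditions -/

/-- The necessary conditions of order one and two at a global maximum of a function of one
variable. -/
theorem deriv_eq_zero_and_deriv2_nonpos_of_max {h h' : ℝ → ℝ} {x c : ℝ}
    (hh : ∀ t, HasDerivAt h (h' t) t) (hh' : HasDerivAt h' c x) (hmax : ∀ t, h t ≤ h x) :
    h' x = 0 ∧ c ≤ 0 := by
  have h0 : h' x = 0 := IsLocalMax.hasDerivAt_eq_zero (Filter.Eventually.of_forall hmax) (hh x)
  refine ⟨h0, le_of_not_gt fun hc => ?_⟩
  -- If `c > 0`, then `h'` is positive just to the right of `x`.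
  have hev : ∀ᶠ t in nhdsWithin x (Set.Ioi x), 0 < slope h' x t :=
    ((hasDerivAt_iff_tendsto_slope.1 hh').eventually_const_lt hc).filter_mono
      (nhdsWithin_mono x fun t ht => ne_of_gt ht)
  obtain ⟨b, hb, hsub⟩ := mem_nhdsGT_iff_exists_Ioc_subset.1 hev
  obtain ⟨ξ, hξ, hslope⟩ := exists_hasDerivAt_eq_slope h h' hb
    (fun t _ => (hh t).continuousAt.continuousWithinAt) fun t _ => hh t
  have h1 : 0 < slope h' x ξ := hsub ⟨hξ.1, hξ.2.le⟩
  rw [slope_def_field, h0, sub_zero, hslope] at h1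
  have hbx : 0 < b - x := sub_pos.2 hb
  have h2 : h b - h x ≤ 0 := sub_nonpos.2 (hmax b)
  exact absurd h1 (not_lt.2 (div_nonpos_of_nonpos_of_nonneg
    (div_nonpos_of_nonpos_of_nonneg h2 hbx.le) (sub_pos.2 hξ.1).le))

theorem sum_sum_filter_mem (f : ι → Finset ι → ℝ) :
    ∑ e, ∑ A ∈ Finset.univ.filter (fun A : Finset ι => e ∈ A), f e A = ∑ A, ∑ e ∈ A, f e A :=
  Finset.sum_comm' (by simp)

/-- The conditions of order one and two at a maximizer of the potential, in the direction `s` of the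
logarithmic coordinates. The second-order term at `A` is `p A` times the
variance of `s` under the weights `v_j^α / ∑_{i ∈ A} v_i^α`. -/
theorem first_second_order {p : Finset ι → ℝ} (hsum : ∑ A, p A = 1) {α : ℝ} (hα : 0 < α)
    {S : Finset ι} {v : ι → ℝ} (hv : v ∈ stdSimplex ℝ ι) (hv0 : ∀ e ∉ S, v e = 0)
    (hpos : ∀ A, p A ≠ 0 → 0 < ∑ j ∈ A, v j ^ α)
    (hmax : ∀ w ∈ stdSimplex ℝ ι, (∀ e ∉ S, w e = 0) → potential p α w ≤ potential p α v)
    (s : ι → ℝ) :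
    ∑ e, s e * drift p α v e = 0 ∧
    -∑ j, v j * s j ^ 2 + α * ∑ A, p A * ((∑ j ∈ A, v j ^ α * s j ^ 2) / (∑ j ∈ A, v j ^ α) -
      ((∑ j ∈ A, v j ^ α * s j) / ∑ j ∈ A, v j ^ α) ^ 2) ≤ 0 := by
  let U : ℕ → Finset ι → ℝ → ℝ := fun n A t =>
    ∑ j ∈ A, v j ^ α * s j ^ n * Real.exp (α * s j * t)
  let B : ℕ → ℝ → ℝ := fun n t => ∑ j, v j * s j ^ n * Real.exp (s j * t)
  have hU : ∀ n A t, HasDerivAt (U n A) (α * U (n + 1) A t) t := fun n A t => by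
    simp only [U, Finset.mul_sum]
    refine HasDerivAt.fun_sum fun j _ => ?_
    refine (((hasDerivAt_id' t).const_mul (α * s j)).exp.const_mul
      (v j ^ α * s j ^ n)).congr_deriv ?_
    ring
  have hB : ∀ n t, HasDerivAt (B n) (B (n + 1) t) t := fun n t => by
    refine HasDerivAt.fun_sum fun j _ => ?_
    refine (((hasDerivAt_id' t).const_mul (s j)).exp.const_mul (v j * s j ^ n)).congr_deriv ?_
    ring
  have hU0 : ∀ A t, p A ≠ 0 → U 0 A t ≠ 0 := fun A t hA => by
    obtain ⟨j, hj, hj'⟩ := Finset.exists_ne_zero_of_sum_ne_zero (hpos A hA).ne'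
    have h0 : ∀ j, 0 ≤ v j ^ α := fun j => Real.rpow_nonneg (hv.1 j) α
    refine (Finset.sum_pos' (fun j _ => ?_) ⟨j, hj, ?_⟩).ne'
    · simpa using mul_nonneg (h0 j) (Real.exp_pos _).le
    · simpa using mul_pos ((h0 j).lt_of_ne' hj') (Real.exp_pos _)
  have hd1 : ∀ t, HasDerivAt (fun t => α * (1 - B 0 t) + ∑ A, p A * Real.log (U 0 A t))
      (α * (-B 1 t) + ∑ A, p A * (α * (U 1 A t / U 0 A t))) t := fun t => by
    refine (((hB 0 t).const_sub 1).const_mul α).add (HasDerivAt.fun_sum fun A _ => ?_)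
    by_cases hA : p A = 0
    · simpa [hA] using hasDerivAt_const t (0 : ℝ)
    · refine (((hU 0 A t).log (hU0 A t hA)).const_mul (p A)).congr_deriv ?_
      ring
  have hd2 : HasDerivAt (fun t => α * (-B 1 t) + ∑ A, p A * (α * (U 1 A t / U 0 A t)))
      (α * (-B 2 0) + ∑ A, p A * (α * (α * (U 2 A 0 / U 0 A 0 - (U 1 A 0 / U 0 A 0) ^ 2)))) 0 := by
    refine ((hB 1 0).neg.const_mul α).add (HasDerivAt.fun_sum fun A _ => ?_)
    by_cases hA : p A = 0
    · simpa [hA] using hasDerivAt_const (0 : ℝ) (0 : ℝ)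
    · refine ((((hU 1 A 0).div (hU 0 A 0) (hU0 A 0 hA)).const_mul α).const_mul
        (p A)).congr_deriv ?_
      have := hU0 A 0 hA
      field_simp
  obtain ⟨h1, h2⟩ := deriv_eq_zero_and_deriv2_nonpos_of_max hd1 hd2 fun t => by
    have h := log_potential_curve_le hsum hα hv hv0 hpos hmax s t
    have hv1 := hv.2
    simpa [U, B, hv1] using h
  simp only [U, B, mul_zero, Real.exp_zero, mul_one, pow_one, pow_zero] at h1 h2
  constructor
  · have : ∑ e, s e * drift p α v e =
        -∑ j, v j * s j + ∑ A, p A * ((∑ j ∈ A, v j ^ α * s j) / ∑ j ∈ A, v j ^ α) := by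
      simp only [drift, mul_add, Finset.sum_add_distrib, Finset.mul_sum, sum_sum_filter_mem]
      congr 1
      · rw [← Finset.sum_neg_distrib]; exact Finset.sum_congr rfl fun j _ => by ring
      · refine Finset.sum_congr rfl fun A _ => ?_
        rw [Finset.sum_div, Finset.mul_sum]
        exact Finset.sum_congr rfl fun j _ => by ring
    rw [this]
    refine (mul_eq_zero.1 (?_ : α * _ = 0)).resolve_left hα.ne'
    rw [← h1, mul_add, Finset.mul_sum]
    exact congrArg _ (Finset.sum_congr rfl fun A _ => by ring)
  · refine nonpos_of_mul_nonpos_right (?_ : α * _ ≤ 0) hα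
    refine le_of_eq_of_le ?_ h2
    rw [mul_add, Finset.mul_sum, Finset.mul_sum]
    exact congrArg _ (Finset.sum_congr rfl fun A _ => by ring)

/-! ### The Jacobian -/

/-- The entry `∂F_e/∂v_k` of the Jacobian in closed form. -/
noncomputable def driftPartial (p : Finset ι → ℝ) (α : ℝ) (v : ι → ℝ) (e k : ι) : ℝ :=
  -(if e = k then 1 else 0) + ∑ A ∈ Finset.univ.filter (fun A : Finset ι => e ∈ A),
    p A * (((if e = k then α * v k ^ (α - 1) else 0) * ∑ j ∈ A, v j ^ α -
      v e ^ α * ∑ j ∈ A, if j = k then α * v k ^ (α - 1) else 0) / (∑ j ∈ A, v j ^ α) ^ 2)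

theorem hasDerivAt_drift_update {p : Finset ι → ℝ} {α : ℝ} (hα : 1 ≤ α) {v : ι → ℝ}
    (hpos : ∀ A, p A ≠ 0 → 0 < ∑ j ∈ A, v j ^ α) (e k : ι) :
    HasDerivAt (fun t : ℝ => drift p α (Function.update v k t) e) (driftPartial p α v e k)
      (v k) := by
  have hid : ∀ j, HasDerivAt (fun t : ℝ => Function.update v k t j)
      (if j = k then 1 else 0) (v k) := fun j => by
      by_cases hj : j = k
      · subst hj; simpa using hasDerivAt_id' (v j)
      · simpa [hj] using hasDerivAt_const (v k) (v j)
  have hpow : ∀ j, HasDerivAt (fun t : ℝ => Function.update v k t j ^ α)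
      (if j = k then α * v k ^ (α - 1) else 0) (v k) := fun j => by
    by_cases hj : j = k
    · subst hj; simpa using Real.hasDerivAt_rpow_const (x := v j) (Or.inr hα)
    · simpa [hj] using hasDerivAt_const (v k) (v j ^ α)
  refine (hid e).neg.add (HasDerivAt.fun_sum fun A _ => ?_)
  by_cases hA : p A = 0
  · simpa [hA] using hasDerivAt_const (v k) (0 : ℝ)
  have := (((hpow e).div (HasDerivAt.fun_sum fun j (_ : j ∈ A) => hpow j)
    (by simpa using (hpos A hA).ne')).const_mul (p A))
  simpa using this

theorem hasPartials_of_pos {p : Finset ι → ℝ} {α : ℝ} (hα : 1 ≤ α) {v : ι → ℝ}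
    (hpos : ∀ A, p A ≠ 0 → 0 < ∑ j ∈ A, v j ^ α) : HasPartials p α v := fun e k =>
  (hasDerivAt_drift_update hα hpos e k).differentiableAt.differentiableWithinAt

theorem jacobian_apply {p : Finset ι → ℝ} {α : ℝ} (hα : 1 ≤ α) {v : ι → ℝ} (hv : ∀ e, 0 ≤ v e)
    (hpos : ∀ A, p A ≠ 0 → 0 < ∑ j ∈ A, v j ^ α) (e k : ι) :
    jacobian p α v e k = driftPartial p α v e k :=
  (hasDerivAt_drift_update hα hpos e k).hasDerivWithinAt.derivWithin
    (uniqueDiffOn_Ici (0 : ℝ) (v k) (hv k))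

/-- The Jacobian applied to a vector `u`, in terms of the logarithmic velocities `u_j / v_j`. Where
`v_j = 0` these are `0` by convention, which is harmless as the weight `v_j ^ α` vanishes. -/
theorem sum_driftPartial_mul {p : Finset ι → ℝ} {α : ℝ} (hα : 1 < α) {v : ι → ℝ}
    (hv : ∀ e, 0 ≤ v e) (hpos : ∀ A, p A ≠ 0 → 0 < ∑ j ∈ A, v j ^ α) (u : ι → ℝ) (e : ι) :
    ∑ k, driftPartial p α v e k * u k = -u e + α * v e ^ α *
      ∑ A ∈ Finset.univ.filter (fun A : Finset ι => e ∈ A), p A * (u e / v e / (∑ j ∈ A, v j ^ α) -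
        (∑ j ∈ A, v j ^ α * (u j / v j)) / (∑ j ∈ A, v j ^ α) ^ 2) := by
  have hpw : ∀ j, v j ^ (α - 1) * u j = v j ^ α * (u j / v j) := fun j => by
    rcases (hv j).eq_or_lt with h | h
    · rw [← h, Real.zero_rpow (by linarith), Real.zero_rpow (by linarith)]; ring
    · rw [Real.rpow_sub_one h.ne']; ring
  simp only [driftPartial, add_mul, Finset.sum_add_distrib, Finset.sum_mul]
  congr 1
  · simp
  rw [Finset.sum_comm, Finset.mul_sum]
  refine Finset.sum_congr rfl fun A _ => ?_
  by_cases hA : p A = 0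
  · simp [hA]
  have hT := (hpos A hA).ne'
  set T := ∑ j ∈ A, v j ^ α
  have hsum : ∀ c : ι → ℝ, (∑ k, (∑ j ∈ A, if j = k then c k else 0) * u k) =
      ∑ k ∈ A, c k * u k := fun c => by
    simp
  calc _ = p A / T ^ 2 * (T * (∑ k, (if e = k then α * v k ^ (α - 1) else 0) * u k) -
        v e ^ α * ∑ k, (∑ j ∈ A, if j = k then α * v k ^ (α - 1) else 0) * u k) := by
        rw [Finset.mul_sum, Finset.mul_sum, ← Finset.sum_sub_distrib, Finset.mul_sum]
        exact Finset.sum_congr rfl fun k _ => by ring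
    _ = p A / T ^ 2 * (T * (α * (v e ^ α * (u e / v e))) -
        v e ^ α * (α * ∑ j ∈ A, v j ^ α * (u j / v j))) := by
        rw [hsum, Finset.mul_sum _ _ α]
        simp only [mul_assoc, hpw, ite_mul, zero_mul, Finset.sum_ite_eq, Finset.mem_univ, if_true]
    _ = _ := by field_simp

/-- The weights are `1 / v_e` where `v_e ≠ 0`, so that in the logarithmic velocities
`u_e / v_e` the form on these coordinates is the second-order expression above. -/
theorem sum_weighted_jacobian_nonpos {p : Finset ι → ℝ} (hsum : ∑ A, p A = 1) {α : ℝ}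
    (hα : 1 < α) {S : Finset ι} {v : ι → ℝ} (hv : v ∈ stdSimplex ℝ ι) (hv0 : ∀ e ∉ S, v e = 0)
    (hpos : ∀ A, p A ≠ 0 → 0 < ∑ j ∈ A, v j ^ α)
    (hmax : ∀ w ∈ stdSimplex ℝ ι, (∀ e ∉ S, w e = 0) → potential p α w ≤ potential p α v)
    (u : ι → ℝ) :
    ∑ e, (if v e = 0 then 1 else (v e)⁻¹) * u e * ∑ k, jacobian p α v e k * u k ≤ 0 := by
  have h2 := (first_second_order hsum (one_pos.trans hα) hv hv0 hpos hmax fun e => u e / v e).2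
  refine le_trans ?_ h2
  simp only [jacobian_apply hα.le hv.1 hpos, sum_driftPartial_mul hα hv.1 hpos]
  have hswap : ∑ A, p A * ((∑ j ∈ A, v j ^ α * (u j / v j) ^ 2) / (∑ j ∈ A, v j ^ α) -
      ((∑ j ∈ A, v j ^ α * (u j / v j)) / ∑ j ∈ A, v j ^ α) ^ 2) =
      ∑ e, v e ^ α * (u e / v e) * ∑ A ∈ Finset.univ.filter (fun A : Finset ι => e ∈ A),
        p A * (u e / v e / (∑ j ∈ A, v j ^ α) -
          (∑ j ∈ A, v j ^ α * (u j / v j)) / (∑ j ∈ A, v j ^ α) ^ 2) := by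
    simp only [Finset.mul_sum, sum_sum_filter_mem]
    refine Finset.sum_congr rfl fun A _ => ?_
    rw [Finset.sum_div, div_pow, sq (∑ j ∈ A, v j ^ α * (u j / v j)), mul_div_assoc,
      Finset.sum_mul (s := A), ← Finset.sum_sub_distrib, Finset.mul_sum]
    exact Finset.sum_congr rfl fun j _ => by ring
  rw [hswap, ← Finset.sum_neg_distrib, Finset.mul_sum, ← Finset.sum_add_distrib]
  refine Finset.sum_le_sum fun e _ => ?_
  by_cases he : v e = 0
  · have : (0 : ℝ) ^ α = 0 := Real.zero_rpow (by linarith)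
    simp only [he, this, if_true, mul_zero, zero_mul, neg_zero, add_zero]
    nlinarith [sq_nonneg (u e)]
  · rw [if_neg he]
    refine le_of_eq ?_
    field_simp

/-- If `diag(d) M` has nonpositive quadratic form for some positive weights `d`, no complex
eigenvalue of `M` has positive real part. -/
theorem re_eigenvalue_nonpos {M : Matrix ι ι ℝ} {d : ι → ℝ} (hd : ∀ e, 0 < d e)
    (hM : ∀ u : ι → ℝ, ∑ e, d e * u e * ∑ k, M e k * u k ≤ 0) {z : ℂ}
    (hz : Module.End.HasEigenvalue (Matrix.toLin' (M.map Complex.ofReal)) z) : z.re ≤ 0 := by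
  obtain ⟨w, hw, hw0⟩ := hz.exists_hasEigenvector
  rw [Module.End.mem_eigenspace_iff] at hw
  have hrow : ∀ e, ∑ k, (M e k : ℂ) * w k = z * w e := fun e => by
    simpa [Matrix.mulVec, dotProduct] using congrFun hw e
  -- The form at `re w` plus the form at `im w` is the real part of the pairing of `M w = z w` with
  -- `d w̄`, in which the terms with `im z` cancel.
  have hre : ∀ e, ∑ k, M e k * (w k).re = z.re * (w e).re - z.im * (w e).im := fun e => by
    simpa using congrArg Complex.re (hrow e)
  have him : ∀ e, ∑ k, M e k * (w k).im = z.re * (w e).im + z.im * (w e).re := fun e => by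
    simpa using congrArg Complex.im (hrow e)
  have h1 := hM fun e => (w e).re
  have h2 := hM fun e => (w e).im
  simp only [hre] at h1
  simp only [him] at h2
  have hsum : z.re * ∑ e, d e * ((w e).re ^ 2 + (w e).im ^ 2) ≤ 0 := by
    refine le_trans (le_of_eq ?_) (add_nonpos h1 h2)
    rw [Finset.mul_sum, ← Finset.sum_add_distrib]
    exact Finset.sum_congr rfl fun e _ => by ring
  obtain ⟨e, he⟩ : ∃ e, w e ≠ 0 := Function.ne_iff.1 hw0
  have hpos : 0 < ∑ e, d e * ((w e).re ^ 2 + (w e).im ^ 2) := by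
    refine Finset.sum_pos' (fun e _ => mul_nonneg (hd e).le (by positivity))
      ⟨e, Finset.mem_univ _, mul_pos (hd e) ?_⟩
    have := Complex.normSq_pos.2 he
    rw [Complex.normSq_apply] at this
    nlinarith
  exact le_of_not_gt fun h => absurd hsum (not_le.2 (mul_pos h hpos))

/-- If every set drawn with positive probability meets `S`, and every `e ∈ S` is the only element of
`S` in some such set, then some linearly stable or critical equilibrium has support exactly `S`. -/
theorem exists_stable_or_critical {p : Finset ι → ℝ} (hp : ∀ A, 0 ≤ p A) (hsum : ∑ A, p A = 1)
    {α : ℝ} (hα : 1 < α) (S : Finset ι) (hmeet : ∀ A, p A ≠ 0 → ∃ e ∈ A, e ∈ S)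
    (hpriv : ∀ e ∈ S, ∃ A, p A ≠ 0 ∧ ∀ j ∈ A, j ∈ S → j = e) :
    ∃ v : ι → ℝ, (∀ e ∈ S, 0 < v e) ∧ (∀ e ∉ S, v e = 0) ∧
      (IsLinearlyStable p α v ∨ IsCritical p α v) := by
  have hα0 : 0 < α := one_pos.trans hα
  have hS : S.Nonempty := by
    obtain ⟨A, -, hA⟩ := Finset.exists_ne_zero_of_sum_ne_zero (hsum.symm ▸ one_ne_zero)
    obtain ⟨e, -, he⟩ := hmeet A hA
    exact ⟨e, he⟩
  obtain ⟨v, hv, hv0, hpos, hmax⟩ := exists_isMaxOn_potential hp hα0 hS hmeet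
  have heq : IsEquilibrium p α v := ⟨hv, fun e => by
    simpa [Pi.single_apply] using
      (first_second_order hsum hα0 hv hv0 hpos hmax (Pi.single e 1)).1⟩
  have hpart := hasPartials_of_pos hα.le hpos
  have hunst : ¬ IsLinearlyUnstable p α v := fun ⟨_, _, z, hz, hz0⟩ =>
    absurd (re_eigenvalue_nonpos (d := fun e => if v e = 0 then 1 else (v e)⁻¹) (fun e => by
      split_ifs with h
      · exact one_pos
      · exact inv_pos.2 ((hv.1 e).lt_of_ne' h))
      (sum_weighted_jacobian_nonpos hsum hα hv hv0 hpos hmax) hz) (not_le.2 hz0)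
  refine ⟨v, fun e he => (hv.1 e).lt_of_ne' fun h0 => ?_, hv0, ?_⟩
  · -- If `v e = 0`, the set `A` in which `e` is alone carries no mass.
    obtain ⟨A, hA, hA'⟩ := hpriv e he
    refine (hpos A hA).ne' (Finset.sum_eq_zero fun j hj => ?_)
    have : v j = 0 := by
      by_cases hjS : j ∈ S
      · rw [hA' j hj hjS, h0]
      · exact hv0 j hjS
    rw [this, Real.zero_rpow hα0.ne']
  · by_cases hst : IsLinearlyStable p α v
    · exact Or.inl hst
    · exact Or.inr ⟨heq, hpart, hst, hunst⟩

end General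

/-! ### Star-forests -/

section Graph

variable {V : Type*} [Fintype V] [DecidableEq V] (G : SimpleGraph V) [DecidableRel G.Adj]

theorem graphLaw_nonneg (A : Finset G.edgeSet) : 0 ≤ graphLaw G A := by
  unfold graphLaw; positivity

theorem sum_graphLaw [Nonempty V] : ∑ A, graphLaw G A = 1 := by
  simp only [graphLaw, ← Finset.sum_div]
  rw [div_eq_one_iff_eq (by simp), ← Nat.cast_sum,
    ← Finset.card_eq_sum_card_fiberwise (fun _ _ => Finset.mem_coe.2 (Finset.mem_univ _)),
    Finset.card_univ]

theorem graphLaw_incident_ne_zero [Nonempty V] (x : V) : graphLaw G (incident G x) ≠ 0 := by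
  refine div_ne_zero (Nat.cast_ne_zero.2 (Finset.card_ne_zero.2 ⟨x, by simp⟩)) (by simp)

variable {G}

theorem exists_incident_eq_of_graphLaw_ne_zero {A : Finset G.edgeSet} (hA : graphLaw G A ≠ 0) :
    ∃ x, incident G x = A := by
  by_contra! h
  exact hA (by simp [graphLaw, h])

theorem IsClusterCollection.exists_clusterEdge {C : Finset G.Subgraph}
    (hC : IsClusterCollection C) (x : V) : ∃ e ∈ incident G x, IsClusterEdge C e := by
  obtain ⟨H, hH, hx⟩ := hC.cover x
  have : Nontrivial H.verts :=
    Set.nontrivial_coe_sort.2 ((Set.one_lt_ncard_iff_nontrivial).1 (hC.nontrivial H hH))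
  obtain ⟨y, hy⟩ := (hC.connected H hH).preconnected.exists_adj_of_nontrivial ⟨x, hx⟩
  exact ⟨⟨s(x, y), hy.adj_sub⟩, by simp [incident], H, hH, hy⟩

/-- The vertex is the endpoint of `e` other than the center of its star. -/
theorem IsStarForest.exists_private_vertex {C : Finset G.Subgraph} (hC : IsStarForest C)
    {e : G.edgeSet} (he : IsClusterEdge C e) :
    ∃ x, ∀ e' ∈ incident G x, IsClusterEdge C e' → e' = e := by
  obtain ⟨H, hH, heH⟩ := he
  obtain ⟨c, hc⟩ := hC.2 H hH
  have hstar : ∀ {a b}, H.Adj a b → a = c ∨ b = c := fun {a b} hab => by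
    have h : H.coe.Adj ⟨a, hab.fst_mem⟩ ⟨b, hab.snd_mem⟩ := hab
    rw [hc, SimpleGraph.starGraph_adj] at h
    simpa [Subtype.ext_iff] using h.2
  obtain ⟨y, hyc, hey⟩ : ∃ y, H.Adj c y ∧ (e : Sym2 V) = s(↑c, y) := by
    obtain ⟨e, he⟩ := e
    induction e with | _ a b
    rcases hstar heH with rfl | rfl
    · exact ⟨b, heH, rfl⟩
    · exact ⟨a, SimpleGraph.Subgraph.Adj.symm heH, Sym2.eq_swap⟩
  refine ⟨y, fun e' he' ⟨K, hK, he'K⟩ => Subtype.ext ?_⟩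
  obtain ⟨z, hz⟩ : y ∈ (e' : Sym2 V) := by simpa [incident] using he'
  rw [hz] at he'K
  have hyz : K.Adj y z := he'K
  obtain rfl : H = K := by
    by_contra hne
    exact Set.disjoint_left.1 (hC.1.disjoint H hH K hK hne) hyc.snd_mem hyz.fst_mem
  obtain rfl : z = c := (hstar hyz).resolve_left hyc.adj_sub.ne'
  rw [hz, hey, Sym2.eq_swap]

end Graph

end WARM

theorem theorem8 {V : Type*} [Fintype V] [Nonempty V] [DecidableEq V]
    (G : SimpleGraph V) [DecidableRel G.Adj] (α : ℝ) (hα : 1 < α)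
    (C : Finset G.Subgraph) (hC : WARM.IsStarForest C) :
    WARM.AdmitsStableAllocation C α := by
  classical
  obtain ⟨v, hpos, hzero, hst⟩ := WARM.exists_stable_or_critical (WARM.graphLaw_nonneg G)
    (WARM.sum_graphLaw G) hα (Finset.univ.filter (WARM.IsClusterEdge C))
    (fun A hA => by
      obtain ⟨x, rfl⟩ := WARM.exists_incident_eq_of_graphLaw_ne_zero hA
      simpa using hC.1.exists_clusterEdge x)
    (fun e he => by
      obtain ⟨x, hx⟩ := hC.exists_private_vertex (by simpa using he)
      exact ⟨_, WARM.graphLaw_incident_ne_zero G x, by simpa using hx⟩)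
  exact ⟨v, by simpa using hpos, by simpa using hzero, hst⟩
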